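/- Let $f_c\ge 0$ be an integer and let $\varepsilon^{(1)}_k,\varepsilon^{(2)}_k$, $k\in\{-f_c,\dots,f_c\}$, be $2(2f_c+1)$ independent real random variables, each with the standard normal distribution $\mathcal N(0,1)$. Put $\varepsilon_k=\varepsilon^{(1)}_k+\mathrm i\,\varepsilon^{(2)}_k$ and $$Z(t)=\sum_{k=-f_c}^{f_c}\varepsilon_k\,e^{2\pi\mathrm i kt},\qquad t\in[0,1].$$ Then, for every real $u>\sqrt2$, $$\mathbb P\Big\{\sup_{t\in[0,1]}|Z(t)|>u\Big\}\le 4\left(\exp\Big(-\frac{u^2}{2(2f_c+1)}\Big)+\sqrt{\frac{f_c(f_c+1)}{3}}\,\exp\Big(-\frac{u^2}{4(2f_c+1)}\Big)\right).$$ -/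

import Mathlib

noncomputable section

/-- The set of frequencies `{-f_c, …, f_c}`. -/
abbrev Freq (fc : ℕ) : Type := {k : ℤ // k ∈ Finset.Icc (-(fc : ℤ)) (fc : ℤ)}

/-- The trigonometric function `t ↦ exp (2 π i k t)`. -/
def trigFun (k : ℤ) (t : ℝ) : ℂ :=
  Complex.exp (2 * (Real.pi : ℂ) * Complex.I * (k : ℂ) * (t : ℂ))

/-- The trigonometric polynomial `∑_{|k| ≤ f_c} ε_k exp (2 π i k t)`. -/
def trigPoly {fc : ℕ} (ε : Freq fc → ℂ) (t : ℝ) : ℂ :=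
  ∑ k : Freq fc, ε k * trigFun (k : ℤ) t

end

/-!
Write `Z' t` for the derivative of the random curve `Z`. The argument counts crossings in the
manner of Rice, with a smooth step `φ` across a level just below `u²` instead of a sharp one.
Since `t ↦ φ (‖Z t‖²)` is a loop, its maximum exceeds its value at `0` by at most half of its total
variation, so Markov's inequality gives
`P (max ‖Z‖ > u) ≤ 𝔼 φ (‖Z 0‖²) + ½ ∫₀¹ 𝔼 (φ' (‖Z t‖²) * |2 ⟪Z t, Z' t⟫|) dt`.
The frequencies `-f_c, …, f_c` add up to zero, so `Z t` and `Z' t` are uncorrelated, hence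
independent. Conditionally on `Z t`, the inner product is Gaussian with standard deviation
proportional to `‖Z t‖`, which is at most `u` wherever `φ'` does not vanish, and `‖Z t‖²` is
exponentially distributed. Letting the step shrink to the level `u²` therefore bounds the two terms
by `exp (-u² / (2 (2 f_c + 1)))` and by a multiple of `u * exp (-u² / (2 (2 f_c + 1)))`.
-/

open MeasureTheory ProbabilityTheory Set Filter
open scoped ENNReal NNReal Topology ComplexConjugate RealInnerProductSpace

section Loops

variable {E : Type*} [NormedAddCommGroup E] [NormedSpace ℝ E] [CompleteSpace E]

theorem two_mul_enorm_sub_le_lintegral_enorm_deriv {f f' : ℝ → E} {a b t : ℝ}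
    (hf : ∀ s ∈ Icc a b, HasDerivAt f (f' s) s) (hf' : IntervalIntegrable f' volume a b)
    (hloop : f a = f b) (ht : t ∈ Icc a b) :
    2 * ‖f t - f a‖ₑ ≤ ∫⁻ s in Ioc a b, ‖f' s‖ₑ := by
  have arc_le : ∀ {c d : ℝ}, a ≤ c → c ≤ d → d ≤ b → ‖f d - f c‖ₑ ≤ ∫⁻ s in Ioc c d, ‖f' s‖ₑ := by
    intro c d hac hcd hdb
    have hsub : uIcc c d ⊆ Icc a b := by
      rw [uIcc_of_le hcd]
      exact Icc_subset_Icc hac hdb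
    rw [← intervalIntegral.integral_eq_sub_of_hasDerivAt (fun s hs ↦ hf s (hsub hs))
      (hf'.mono_set (hsub.trans Icc_subset_uIcc)), intervalIntegral.integral_of_le hcd]
    exact enorm_integral_le_lintegral_enorm _
  -- The loop reaches `f t` from its base point along either of its two arcs.
  calc 2 * ‖f t - f a‖ₑ = ‖f t - f a‖ₑ + ‖f b - f t‖ₑ := by
        rw [two_mul, ← hloop, enorm_sub_rev (f a) (f t)]
    _ ≤ (∫⁻ s in Ioc a t, ‖f' s‖ₑ) + ∫⁻ s in Ioc t b, ‖f' s‖ₑ :=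
        add_le_add (arc_le le_rfl ht.1 ht.2) (arc_le ht.1 ht.2 le_rfl)
    _ = ∫⁻ s in Ioc a b, ‖f' s‖ₑ := by
        rw [← lintegral_union measurableSet_Ioc (Ioc_disjoint_Ioc_of_le le_rfl),
          Ioc_union_Ioc_eq_Ioc ht.1 ht.2]

theorem enorm_le_enorm_add_lintegral_enorm_deriv {f f' : ℝ → E} {a b t : ℝ}
    (hf : ∀ s ∈ Icc a b, HasDerivAt f (f' s) s) (hf' : IntervalIntegrable f' volume a b)
    (hloop : f a = f b) (ht : t ∈ Icc a b) :
    ‖f t‖ₑ ≤ ‖f a‖ₑ + 2⁻¹ * ∫⁻ s in Ioc a b, ‖f' s‖ₑ := by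
  have half : ‖f t - f a‖ₑ ≤ 2⁻¹ * ∫⁻ s in Ioc a b, ‖f' s‖ₑ := by
    rw [← ENNReal.mul_le_iff_le_inv two_ne_zero ENNReal.ofNat_ne_top]
    exact two_mul_enorm_sub_le_lintegral_enorm_deriv hf hf' hloop ht
  calc ‖f t‖ₑ = ‖f a + (f t - f a)‖ₑ := by rw [add_sub_cancel]
    _ ≤ ‖f a‖ₑ + ‖f t - f a‖ₑ := enorm_add_le _ _
    _ ≤ _ := by gcongr

theorem measure_exists_one_le_enorm_le [MeasurableSpace E] [OpensMeasurableSpace E]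
    {Ω : Type*} [MeasurableSpace Ω] {P : Measure Ω} [SFinite P] {Y Y' : ℝ → Ω → E} {a b : ℝ}
    (hY : ∀ ω, ∀ t ∈ Icc a b, HasDerivAt (Y · ω) (Y' t ω) t)
    (hY' : ∀ ω, IntervalIntegrable (Y' · ω) volume a b) (hloop : ∀ ω, Y a ω = Y b ω)
    (hYa : AEMeasurable (Y a) P)
    (hY'm : AEMeasurable (fun p : Ω × ℝ ↦ Y' p.2 p.1) (P.prod (volume.restrict (Ioc a b)))) :
    P {ω | ∃ t ∈ Icc a b, 1 ≤ ‖Y t ω‖ₑ} ≤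
      ∫⁻ ω, ‖Y a ω‖ₑ ∂P + 2⁻¹ * ∫⁻ t in Ioc a b, ∫⁻ ω, ‖Y' t ω‖ₑ ∂P := by
  calc P {ω | ∃ t ∈ Icc a b, 1 ≤ ‖Y t ω‖ₑ}
      ≤ ∫⁻ ω, (‖Y a ω‖ₑ + 2⁻¹ * ∫⁻ t in Ioc a b, ‖Y' t ω‖ₑ) ∂P := by
        refine meas_le_lintegral₀
          (hYa.enorm.add (hY'm.enorm.lintegral_prod_right'.const_mul _)) ?_
        rintro ω ⟨t, ht, h1⟩
        exact h1.trans (enorm_le_enorm_add_lintegral_enorm_deriv (hY ω) (hY' ω) (hloop ω) ht)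
    _ = ∫⁻ ω, ‖Y a ω‖ₑ ∂P + 2⁻¹ * ∫⁻ t in Ioc a b, ∫⁻ ω, ‖Y' t ω‖ₑ ∂P := by
        rw [lintegral_add_left' hYa.enorm, lintegral_const_mul' _ _ (by simp),
          lintegral_lintegral_swap hY'm.enorm]

end Loops

section SmoothStep

/-- A smooth monotone step from `0` on `(-∞, α]` to `1` on `[β, ∞)`, when `α < β`. Composing a
random curve with it turns crossings of the strip `[α, β]` into variation. -/
noncomputable def smoothStep (α β s : ℝ) : ℝ := Real.smoothTransition ((s - α) / (β - α))

variable {α β s : ℝ}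

theorem contDiff_smoothStep : ContDiff ℝ 1 (smoothStep α β) :=
  (Real.smoothTransition.contDiff (n := 1)).comp (by fun_prop)

theorem hasDerivAt_smoothStep : HasDerivAt (smoothStep α β) (deriv (smoothStep α β) s) s :=
  (contDiff_smoothStep.differentiable one_ne_zero s).hasDerivAt

theorem continuous_deriv_smoothStep : Continuous (deriv (smoothStep α β)) :=
  contDiff_smoothStep.continuous_deriv_one

theorem smoothStep_le_one : smoothStep α β s ≤ 1 := Real.smoothTransition.le_one _

theorem smoothStep_nonneg : 0 ≤ smoothStep α β s := Real.smoothTransition.nonneg _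

theorem smoothStep_of_le (hαβ : α < β) (hs : s ≤ α) : smoothStep α β s = 0 :=
  Real.smoothTransition.zero_of_nonpos
    (div_nonpos_of_nonpos_of_nonneg (sub_nonpos.2 hs) (sub_pos.2 hαβ).le)

theorem smoothStep_of_ge (hαβ : α < β) (hs : β ≤ s) : smoothStep α β s = 1 :=
  Real.smoothTransition.one_of_one_le ((one_le_div (sub_pos.2 hαβ)).2 (by gcongr))

theorem monotone_smoothStep (hαβ : α < β) : Monotone (smoothStep α β) := fun s t hst ↦
  Real.smoothTransition.monotone (div_le_div_of_nonneg_right (by gcongr) (sub_pos.2 hαβ).le)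

theorem support_deriv_smoothStep_subset (hαβ : α < β) :
    Function.support (deriv (smoothStep α β)) ⊆ Icc α β := by
  refine Function.support_subset_iff'.2 fun s hs ↦ ?_
  rcases not_and_or.1 hs with hs | hs
  · have : smoothStep α β =ᶠ[𝓝 s] fun _ ↦ 0 := by
      filter_upwards [Iio_mem_nhds (not_le.1 hs)] with r hr using smoothStep_of_le hαβ (le_of_lt hr)
    rw [this.deriv_eq, deriv_const]
  · have : smoothStep α β =ᶠ[𝓝 s] fun _ ↦ 1 := by
      filter_upwards [Ioi_mem_nhds (not_le.1 hs)] with r hr using smoothStep_of_ge hαβ (le_of_lt hr)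
    rw [this.deriv_eq, deriv_const]

theorem lintegral_enorm_deriv_smoothStep (hαβ : α < β) :
    ∫⁻ s, ‖deriv (smoothStep α β) s‖ₑ = 1 := by
  have hnonneg : ∀ s, 0 ≤ deriv (smoothStep α β) s := fun s ↦ (monotone_smoothStep hαβ).deriv_nonneg
  have hint : IntervalIntegrable (deriv (smoothStep α β)) volume α β :=
    continuous_deriv_smoothStep.intervalIntegrable _ _
  calc ∫⁻ s, ‖deriv (smoothStep α β) s‖ₑ = ∫⁻ s in Icc α β, ‖deriv (smoothStep α β) s‖ₑ := by
        refine (setLIntegral_eq_of_support_subset ?_).symm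
        simpa using support_deriv_smoothStep_subset hαβ
    _ = ∫⁻ s in Ioc α β, ENNReal.ofReal (deriv (smoothStep α β) s) := by
        rw [setLIntegral_congr Ioc_ae_eq_Icc.symm]
        simp_rw [Real.enorm_of_nonneg (hnonneg _)]
    _ = ENNReal.ofReal (∫ s in α..β, deriv (smoothStep α β) s) := by
        rw [intervalIntegral.integral_of_le hαβ.le,
          ofReal_integral_eq_lintegral_ofReal hint.1 (.of_forall hnonneg)]
    _ = 1 := by
        rw [intervalIntegral.integral_deriv_eq_sub
          (fun _ _ ↦ hasDerivAt_smoothStep.differentiableAt) hint,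
          smoothStep_of_ge hαβ le_rfl, smoothStep_of_le hαβ le_rfl]
        simp

end SmoothStep

section Exponential

variable {r α : ℝ}

theorem expMeasure_Ioi_le (hr : 0 < r) :
    expMeasure r (Ioi α) ≤ ENNReal.ofReal (Real.exp (-(r * α))) := by
  have := isProbabilityMeasure_expMeasure hr
  rw [← ofReal_measureReal, ← compl_Iic, probReal_compl_eq_one_sub measurableSet_Iic,
    ← cdf_eq_real, cdf_expMeasure_eq hr]
  refine ENNReal.ofReal_le_ofReal ?_
  split_ifs with hα
  · simp
  · rw [sub_zero, Real.one_le_exp_iff]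
    nlinarith

theorem lintegral_expMeasure_le (hr : 0 ≤ r) {f : ℝ → ℝ≥0∞} (hf : ∀ s < α, f s = 0) :
    ∫⁻ s, f s ∂expMeasure r ≤ ENNReal.ofReal (r * Real.exp (-(r * α))) * ∫⁻ s, f s := by
  have density_le : ∀ s, exponentialPDF r s * f s ≤
      ENNReal.ofReal (r * Real.exp (-(r * α))) * f s := by
    intro s
    rcases lt_or_ge s α with hs | hs
    · simp [hf s hs]
    · rw [exponentialPDF_eq]
      gcongr
      split_ifs
      · gcongr
      · positivity
  calc ∫⁻ s, f s ∂expMeasure r ≤ ∫⁻ s, exponentialPDF r s * f s :=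
        lintegral_withDensity_le_lintegral_mul _ (measurable_exponentialPDFReal r).ennreal_ofReal f
    _ ≤ ∫⁻ s, ENNReal.ofReal (r * Real.exp (-(r * α))) * f s := lintegral_mono density_le
    _ = _ := lintegral_const_mul' _ _ ENNReal.ofReal_ne_top

variable {β : ℝ}

theorem lintegral_enorm_smoothStep_expMeasure_le (hr : 0 < r) (hαβ : α < β) :
    ∫⁻ s, ‖smoothStep α β s‖ₑ ∂expMeasure r ≤ ENNReal.ofReal (Real.exp (-(r * α))) := by
  have step_le : ∀ s, ‖smoothStep α β s‖ₑ ≤ (Ioi α).indicator 1 s := by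
    intro s
    by_cases hs : α < s
    · simpa [hs, Real.enorm_of_nonneg smoothStep_nonneg] using smoothStep_le_one
    · simp [smoothStep_of_le hαβ (not_lt.1 hs)]
  calc ∫⁻ s, ‖smoothStep α β s‖ₑ ∂expMeasure r ≤ ∫⁻ s, (Ioi α).indicator 1 s ∂expMeasure r :=
        lintegral_mono step_le
    _ = expMeasure r (Ioi α) := lintegral_indicator_one measurableSet_Ioi
    _ ≤ _ := expMeasure_Ioi_le hr

theorem lintegral_enorm_deriv_smoothStep_expMeasure_le (hr : 0 ≤ r) (hαβ : α < β) :
    ∫⁻ s, ‖deriv (smoothStep α β) s‖ₑ ∂expMeasure r ≤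
      ENNReal.ofReal (r * Real.exp (-(r * α))) := by
  have hzero : ∀ s < α, ‖deriv (smoothStep α β) s‖ₑ = 0 := fun s hs ↦ by
    rw [enorm_eq_zero, Function.notMem_support.1
      fun h ↦ hs.not_ge (support_deriv_smoothStep_subset hαβ h).1]
  simpa only [lintegral_enorm_deriv_smoothStep hαβ, mul_one] using lintegral_expMeasure_le hr hzero

end Exponential

section Crossing

variable {Ω : Type*} [MeasurableSpace Ω] {P : Measure Ω} [SFinite P]

theorem measure_exists_ge_le_lintegral_smoothStep {Q Q' : ℝ → Ω → ℝ} {a b α β : ℝ} (hαβ : α < β)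
    (hQ : ∀ ω t, HasDerivAt (Q · ω) (Q' t ω) t) (hQ' : ∀ ω, Continuous (Q' · ω))
    (hloop : ∀ ω, Q a ω = Q b ω) (hQa : AEMeasurable (Q a) P)
    (hQm : AEMeasurable (fun p : Ω × ℝ ↦ Q p.2 p.1) (P.prod volume))
    (hQ'm : AEMeasurable (fun p : Ω × ℝ ↦ Q' p.2 p.1) (P.prod volume)) :
    P {ω | ∃ t ∈ Icc a b, β ≤ Q t ω} ≤
      ∫⁻ ω, ‖smoothStep α β (Q a ω)‖ₑ ∂P +
        2⁻¹ * ∫⁻ t in Ioc a b, ∫⁻ ω, ‖deriv (smoothStep α β) (Q t ω) * Q' t ω‖ₑ ∂P := by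
  have hQc : ∀ ω, Continuous (Q · ω) := fun ω ↦
    continuous_iff_continuousAt.2 fun t ↦ (hQ ω t).continuousAt
  have hY'c : ∀ ω, Continuous fun t ↦ deriv (smoothStep α β) (Q t ω) * Q' t ω := fun ω ↦
    (continuous_deriv_smoothStep.comp (hQc ω)).mul (hQ' ω)
  have hY'm : AEMeasurable (fun p : Ω × ℝ ↦ deriv (smoothStep α β) (Q p.2 p.1) * Q' p.2 p.1)
      (P.prod (volume.restrict (Ioc a b))) :=
    ((continuous_deriv_smoothStep.measurable.comp_aemeasurable hQm).mul hQ'm).mono_ac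
      (Measure.AbsolutelyContinuous.rfl.prod Measure.restrict_le_self.absolutelyContinuous)
  calc P {ω | ∃ t ∈ Icc a b, β ≤ Q t ω}
      ≤ P {ω | ∃ t ∈ Icc a b, 1 ≤ ‖smoothStep α β (Q t ω)‖ₑ} := by
        refine measure_mono fun ω hω ↦ ?_
        obtain ⟨t, ht, hβ⟩ := hω
        exact ⟨t, ht, by rw [smoothStep_of_ge hαβ hβ, enorm_one]⟩
    _ ≤ _ := measure_exists_one_le_enorm_le (fun ω t _ ↦ hasDerivAt_smoothStep.comp t (hQ ω t))
        (fun ω ↦ (hY'c ω).intervalIntegrable a b) (fun ω ↦ congrArg _ (hloop ω))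
        (contDiff_smoothStep.continuous.measurable.comp_aemeasurable hQa) hY'm

end Crossing

section SquaredRadius

theorem lintegral_comp_sq_add_sq {f : ℝ → ℝ≥0∞} (hf : Measurable f) :
    ∫⁻ p : ℝ × ℝ, f (p.1 ^ 2 + p.2 ^ 2) = ENNReal.ofReal Real.pi * ∫⁻ s in Ioi 0, f s := by
  have image_sq : (fun ρ : ℝ ↦ ρ ^ 2) '' Ioi 0 = Ioi 0 := by
    ext s
    refine ⟨?_, fun hs ↦ ⟨√s, Real.sqrt_pos.2 hs, Real.sq_sqrt (le_of_lt hs)⟩⟩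
    rintro ⟨ρ, hρ, rfl⟩
    exact pow_pos (mem_Ioi.1 hρ) 2
  have injOn_sq : InjOn (fun ρ : ℝ ↦ ρ ^ 2) (Ioi 0) := fun ρ hρ σ hσ h ↦
    (pow_left_inj₀ (le_of_lt hρ) (le_of_lt hσ) two_ne_zero).1 h
  calc ∫⁻ p : ℝ × ℝ, f (p.1 ^ 2 + p.2 ^ 2)
      = ∫⁻ p in Ioi (0 : ℝ) ×ˢ Ioo (-Real.pi) Real.pi, ENNReal.ofReal p.1 * f (p.1 ^ 2) := by
        rw [← lintegral_comp_polarCoord_symm, polarCoord_target]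
        refine lintegral_congr fun p ↦ ?_
        rw [polarCoord_symm_apply, smul_eq_mul]
        congr 2
        linear_combination p.1 ^ 2 * Real.sin_sq_add_cos_sq p.2
    _ = ∫⁻ ρ in Ioi (0 : ℝ), ENNReal.ofReal Real.pi * (ENNReal.ofReal |2 * ρ| * f (ρ ^ 2)) := by
        rw [Measure.volume_eq_prod, setLIntegral_prod _ (by fun_prop)]
        refine setLIntegral_congr_fun measurableSet_Ioi fun ρ hρ ↦ ?_
        dsimp only
        rw [setLIntegral_const, Real.volume_Ioo, abs_of_pos (mul_pos two_pos hρ), mul_right_comm,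
          ← mul_assoc, ← ENNReal.ofReal_mul (le_of_lt hρ), ← ENNReal.ofReal_mul Real.pi_pos.le]
        ring_nf
    _ = ENNReal.ofReal Real.pi * ∫⁻ s in Ioi 0, f s := by
        rw [lintegral_const_mul _ (by fun_prop), ← lintegral_image_eq_lintegral_abs_deriv_mul
          measurableSet_Ioi (fun ρ _ ↦ by simpa using (hasDerivAt_pow 2 ρ).hasDerivWithinAt)
          injOn_sq, image_sq]

theorem gaussianPDF_mul_gaussianPDF (v : ℝ≥0) (x y : ℝ) :
    gaussianPDF 0 v x * gaussianPDF 0 v y =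
      ENNReal.ofReal ((2 * Real.pi * v)⁻¹ * Real.exp (-(x ^ 2 + y ^ 2) / (2 * v))) := by
  have hsqrt : (√(2 * Real.pi * v))⁻¹ * (√(2 * Real.pi * v))⁻¹ = (2 * Real.pi * v)⁻¹ := by
    rw [← mul_inv, Real.mul_self_sqrt (by positivity)]
  rw [gaussianPDF, gaussianPDF, ← ENNReal.ofReal_mul (gaussianPDFReal_nonneg _ _ _)]
  simp only [gaussianPDFReal, sub_zero]
  rw [mul_mul_mul_comm, hsqrt, ← Real.exp_add, ← add_div, neg_add]

theorem hasLaw_sq_add_sq_gaussianReal_prod {v : ℝ≥0} (hv : v ≠ 0) :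
    HasLaw (fun p : ℝ × ℝ ↦ p.1 ^ 2 + p.2 ^ 2) (expMeasure (2 * v)⁻¹)
      ((gaussianReal 0 v).prod (gaussianReal 0 v)) := by
  refine ⟨by fun_prop, Measure.ext_of_lintegral _ fun f hf ↦ ?_⟩
  have hdensity : Measurable fun s : ℝ ↦
      ENNReal.ofReal ((2 * Real.pi * v)⁻¹ * Real.exp (-s / (2 * v))) * f s := by fun_prop
  calc ∫⁻ s, f s ∂((gaussianReal 0 v).prod (gaussianReal 0 v)).map (fun p ↦ p.1 ^ 2 + p.2 ^ 2)
      = ∫⁻ p : ℝ × ℝ, ENNReal.ofReal ((2 * Real.pi * v)⁻¹ *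
          Real.exp (-(p.1 ^ 2 + p.2 ^ 2) / (2 * v))) * f (p.1 ^ 2 + p.2 ^ 2) := by
        rw [lintegral_map hf (by fun_prop), gaussianReal_of_var_ne_zero _ hv,
          prod_withDensity (measurable_gaussianPDF 0 v) (measurable_gaussianPDF 0 v),
          lintegral_withDensity_eq_lintegral_mul _ (by fun_prop) (by fun_prop),
          ← Measure.volume_eq_prod]
        simp only [Pi.mul_apply, gaussianPDF_mul_gaussianPDF]
    _ = ∫⁻ s in Ioi 0, exponentialPDF (2 * v)⁻¹ s * f s := by
        rw [lintegral_comp_sq_add_sq hdensity, ← lintegral_const_mul _ hdensity]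
        refine setLIntegral_congr_fun measurableSet_Ioi fun s hs ↦ ?_
        rw [exponentialPDF_of_nonneg (le_of_lt hs), ← mul_assoc,
          ← ENNReal.ofReal_mul Real.pi_pos.le]
        congr 2
        field_simp
    _ = ∫⁻ s, exponentialPDF (2 * v)⁻¹ s * f s := by
        rw [setLIntegral_congr Ioi_ae_eq_Ici]
        refine setLIntegral_eq_of_support_subset (Function.support_subset_iff'.2 fun s hs ↦ ?_)
        rw [exponentialPDF_of_neg (not_le.1 hs), zero_mul]
    _ = ∫⁻ s, f s ∂expMeasure (2 * v)⁻¹ :=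
        (lintegral_withDensity_eq_lintegral_mul _
          (measurable_exponentialPDFReal _).ennreal_ofReal hf).symm

variable {Ω : Type*} [MeasurableSpace Ω] {P : Measure Ω} [IsFiniteMeasure P]

theorem hasLaw_sq_add_sq_of_indepFun {X Y : Ω → ℝ} {v : ℝ≥0} (hv : v ≠ 0)
    (hX : HasLaw X (gaussianReal 0 v) P) (hY : HasLaw Y (gaussianReal 0 v) P)
    (hXY : IndepFun X Y P) :
    HasLaw (fun ω ↦ X ω ^ 2 + Y ω ^ 2) (expMeasure (2 * v)⁻¹) P := by
  have hpair : HasLaw (fun ω ↦ (X ω, Y ω)) ((gaussianReal 0 v).prod (gaussianReal 0 v)) P :=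
    ⟨hX.aemeasurable.prodMk hY.aemeasurable, by
      rw [(indepFun_iff_map_prod_eq_prod_map_map hX.aemeasurable hY.aemeasurable).1 hXY,
        hX.map_eq, hY.map_eq]⟩
  exact (hasLaw_sq_add_sq_gaussianReal_prod hv).comp hpair

end SquaredRadius

section RadialVelocity

variable {Ω E : Type*} [MeasurableSpace Ω] {P : Measure Ω} [IsFiniteMeasure P]
  [NormedAddCommGroup E] [InnerProductSpace ℝ E] [MeasurableSpace E] [OpensMeasurableSpace E]
  [SecondCountableTopology E]

theorem lintegral_mul_enorm_inner_le_of_indepFun {Z V : Ω → E} (hZ : AEMeasurable Z P)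
    (hV : AEMeasurable V P) (hind : IndepFun Z V P) {K : ℝ≥0∞}
    (hK : ∀ x, ∫⁻ ω, ‖⟪x, V ω⟫‖ₑ ∂P ≤ K * ‖x‖ₑ) {φ : E → ℝ≥0∞} (hφ : Measurable φ) :
    ∫⁻ ω, φ (Z ω) * ‖⟪Z ω, V ω⟫‖ₑ ∂P ≤ K * ∫⁻ ω, φ (Z ω) * ‖Z ω‖ₑ ∂P := by
  have hF : Measurable fun q : E × E ↦ φ q.1 * ‖⟪q.1, q.2⟫‖ₑ :=
    (hφ.comp measurable_fst).mul (measurable_fst.inner measurable_snd).enorm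
  have hH : Measurable fun x ↦ φ x * ‖x‖ₑ := hφ.mul measurable_enorm
  calc ∫⁻ ω, φ (Z ω) * ‖⟪Z ω, V ω⟫‖ₑ ∂P
      = ∫⁻ q, φ q.1 * ‖⟪q.1, q.2⟫‖ₑ ∂(P.map fun ω ↦ (Z ω, V ω)) :=
        (lintegral_map' hF.aemeasurable (hZ.prodMk hV)).symm
    _ = ∫⁻ x, ∫⁻ y, φ x * ‖⟪x, y⟫‖ₑ ∂(P.map V) ∂(P.map Z) := by
        rw [(indepFun_iff_map_prod_eq_prod_map_map hZ hV).1 hind, lintegral_prod _ hF.aemeasurable]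
    _ ≤ ∫⁻ x, K * (φ x * ‖x‖ₑ) ∂(P.map Z) := by
        refine lintegral_mono fun x ↦ ?_
        have hx : Measurable fun y : E ↦ ‖⟪x, y⟫‖ₑ := (measurable_const.inner measurable_id).enorm
        rw [lintegral_const_mul _ hx, lintegral_map' hx.aemeasurable hV, mul_left_comm]
        gcongr
        exact hK x
    _ = K * ∫⁻ ω, φ (Z ω) * ‖Z ω‖ₑ ∂P := by
        rw [lintegral_const_mul _ hH, lintegral_map' hH.aemeasurable hZ]

variable {K r u : ℝ}

theorem lintegral_enorm_deriv_smoothStep_norm_sq_le {Z V : Ω → E} {α : ℝ}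
    (hr : 0 ≤ r) (hu : 0 ≤ u) (hK₀ : 0 ≤ K) (hα : α < u ^ 2)
    (hZ : AEMeasurable Z P) (hV : AEMeasurable V P)
    (hlaw : HasLaw (fun ω ↦ ‖Z ω‖ ^ 2) (expMeasure r) P) (hind : IndepFun Z V P)
    (hK : ∀ x, ∫⁻ ω, ‖⟪x, V ω⟫‖ₑ ∂P ≤ ENNReal.ofReal K * ‖x‖ₑ) :
    ∫⁻ ω, ‖deriv (smoothStep α (u ^ 2)) (‖Z ω‖ ^ 2) * (2 * ⟪Z ω, V ω⟫)‖ₑ ∂P ≤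
      2 * ENNReal.ofReal (K * u * (r * Real.exp (-(r * α)))) := by
  set ψ : ℝ → ℝ≥0∞ := fun s ↦ ‖deriv (smoothStep α (u ^ 2)) s‖ₑ
  have hψ : Measurable ψ := continuous_deriv_smoothStep.measurable.enorm
  have radius_le : ∀ x : E, ψ (‖x‖ ^ 2) * ‖x‖ₑ ≤ ENNReal.ofReal u * ψ (‖x‖ ^ 2) := by
    intro x
    by_cases hx : deriv (smoothStep α (u ^ 2)) (‖x‖ ^ 2) = 0
    · simp [ψ, hx]
    · have hxu : ‖x‖ ≤ u :=
        (pow_le_pow_iff_left₀ (norm_nonneg x) hu two_ne_zero).1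
          (support_deriv_smoothStep_subset hα hx).2
      rw [mul_comm, ← ofReal_norm]
      gcongr
  calc ∫⁻ ω, ‖deriv (smoothStep α (u ^ 2)) (‖Z ω‖ ^ 2) * (2 * ⟪Z ω, V ω⟫)‖ₑ ∂P
      = 2 * ∫⁻ ω, ψ (‖Z ω‖ ^ 2) * ‖⟪Z ω, V ω⟫‖ₑ ∂P := by
        rw [← lintegral_const_mul' _ _ ENNReal.ofNat_ne_top]
        refine lintegral_congr fun ω ↦ ?_
        simp only [ψ, enorm_mul, mul_left_comm, Real.enorm_of_nonneg zero_le_two,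
          ENNReal.ofReal_ofNat]
    _ ≤ 2 * (ENNReal.ofReal K * ∫⁻ ω, ψ (‖Z ω‖ ^ 2) * ‖Z ω‖ₑ ∂P) := by
        gcongr
        exact lintegral_mul_enorm_inner_le_of_indepFun hZ hV hind hK
          (hψ.comp (measurable_norm.pow_const 2))
    _ ≤ 2 * (ENNReal.ofReal K * ∫⁻ ω, ENNReal.ofReal u * ψ (‖Z ω‖ ^ 2) ∂P) := by
        gcongr 2 * (ENNReal.ofReal K * ?_)
        exact lintegral_mono fun ω ↦ radius_le (Z ω)
    _ = 2 * (ENNReal.ofReal K * ENNReal.ofReal u * ∫⁻ s, ψ s ∂expMeasure r) := by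
        rw [lintegral_const_mul' _ _ ENNReal.ofReal_ne_top, mul_assoc, ← hlaw.map_eq,
          lintegral_map' hψ.aemeasurable hlaw.aemeasurable]
    _ ≤ _ := by
        rw [ENNReal.ofReal_mul (mul_nonneg hK₀ hu), ENNReal.ofReal_mul hK₀]
        gcongr
        exact lintegral_enorm_deriv_smoothStep_expMeasure_le hr hα

theorem measure_exists_lt_norm_le {Z Z' : ℝ → Ω → E} (hr : 0 < r) (hu : 0 ≤ u) (hK₀ : 0 ≤ K)
    (hZ : ∀ ω t, HasDerivAt (Z · ω) (Z' t ω) t) (hZ' : ∀ ω, Continuous (Z' · ω))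
    (hloop : ∀ ω, Z 0 ω = Z 1 ω) (hZm : AEMeasurable (fun p : Ω × ℝ ↦ Z p.2 p.1) (P.prod volume))
    (hZ'm : AEMeasurable (fun p : Ω × ℝ ↦ Z' p.2 p.1) (P.prod volume))
    (hZt : ∀ t, AEMeasurable (Z t) P) (hZ't : ∀ t, AEMeasurable (Z' t) P)
    (hlaw : ∀ t, HasLaw (fun ω ↦ ‖Z t ω‖ ^ 2) (expMeasure r) P)
    (hind : ∀ t, IndepFun (Z t) (Z' t) P)
    (hK : ∀ t x, ∫⁻ ω, ‖⟪x, Z' t ω⟫‖ₑ ∂P ≤ ENNReal.ofReal K * ‖x‖ₑ) :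
    P {ω | ∃ t ∈ Icc (0 : ℝ) 1, u < ‖Z t ω‖} ≤
      ENNReal.ofReal (Real.exp (-(r * u ^ 2)) * (1 + r * K * u)) := by
  suffices h : ∀ α < u ^ 2, P {ω | ∃ t ∈ Icc (0 : ℝ) 1, u < ‖Z t ω‖} ≤
      ENNReal.ofReal (Real.exp (-(r * α)) * (1 + r * K * u)) by
    have hcont : Continuous fun α ↦ ENNReal.ofReal (Real.exp (-(r * α)) * (1 + r * K * u)) :=
      ENNReal.continuous_ofReal.comp (by fun_prop)
    refine ge_of_tendsto ((hcont.tendsto _).mono_left (nhdsWithin_le_nhds (s := Iio (u ^ 2)))) ?_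
    filter_upwards [self_mem_nhdsWithin] with α hα using h α hα
  intro α hα
  have start_le : ∫⁻ ω, ‖smoothStep α (u ^ 2) (‖Z 0 ω‖ ^ 2)‖ₑ ∂P ≤
      ENNReal.ofReal (Real.exp (-(r * α))) := by
    refine le_of_eq_of_le ?_ (lintegral_enorm_smoothStep_expMeasure_le hr hα)
    rw [← (hlaw 0).map_eq,
      lintegral_map' contDiff_smoothStep.continuous.enorm.aemeasurable (hlaw 0).aemeasurable]
  have hZc : ∀ ω, Continuous (Z · ω) := fun ω ↦
    continuous_iff_continuousAt.2 fun t ↦ (hZ ω t).continuousAt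
  calc P {ω | ∃ t ∈ Icc (0 : ℝ) 1, u < ‖Z t ω‖}
      ≤ P {ω | ∃ t ∈ Icc (0 : ℝ) 1, u ^ 2 ≤ ‖Z t ω‖ ^ 2} := by
        refine measure_mono fun ω hω ↦ ?_
        obtain ⟨t, ht, hut⟩ := hω
        exact ⟨t, ht, by gcongr⟩
    _ ≤ _ := measure_exists_ge_le_lintegral_smoothStep hα (fun ω t ↦ (hZ ω t).norm_sq)
        (fun ω ↦ continuous_const.mul ((hZc ω).inner (hZ' ω))) (fun ω ↦ by rw [hloop])
        (hlaw 0).aemeasurable (hZm.norm.pow_const 2) ((hZm.inner hZ'm).const_mul 2)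
    _ ≤ ENNReal.ofReal (Real.exp (-(r * α))) + 2⁻¹ * ∫⁻ _ in Ioc (0 : ℝ) 1,
          2 * ENNReal.ofReal (K * u * (r * Real.exp (-(r * α)))) := by
        gcongr with t
        exact lintegral_enorm_deriv_smoothStep_norm_sq_le hr.le hu hK₀ hα (hZt t) (hZ't t) (hlaw t)
          (hind t) (hK t)
    _ = ENNReal.ofReal (Real.exp (-(r * α)) * (1 + r * K * u)) := by
        rw [setLIntegral_const, Real.volume_Ioc, sub_zero, ENNReal.ofReal_one, mul_one, ← mul_assoc,
          ENNReal.inv_mul_cancel two_ne_zero ENNReal.ofNat_ne_top, one_mul,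
          ← ENNReal.ofReal_add (by positivity) (by positivity)]
        ring_nf

end RadialVelocity

section LinearForms

variable {Ω ι : Type*} [MeasurableSpace Ω] {P : Measure Ω}

theorem covariance_sum_mul_sum_mul [Fintype ι] [IsFiniteMeasure P] {W : ι → Ω → ℝ}
    (hW : ∀ i, MemLp (W i) 2 P) (hcov : Pairwise fun i j ↦ cov[W i, W j; P] = 0) (a b : ι → ℝ) :
    cov[fun ω ↦ ∑ i, a i * W i ω, fun ω ↦ ∑ i, b i * W i ω; P] =
      ∑ i, a i * b i * Var[W i; P] := by
  rw [covariance_fun_sum_fun_sum (fun i ↦ (hW i).const_mul _) fun i ↦ (hW i).const_mul _]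
  refine Finset.sum_congr rfl fun i _ ↦ ?_
  simp only [covariance_const_mul_left, covariance_const_mul_right]
  rw [Finset.sum_eq_single i (fun j _ hji ↦ by rw [hcov hji.symm, mul_zero, mul_zero]) (by simp),
    covariance_self (hW i).aemeasurable, mul_left_comm, mul_assoc]

theorem lintegral_enorm_le_sqrt_variance [IsProbabilityMeasure P] {X : Ω → ℝ} (hX : MemLp X 2 P)
    (hmean : ∫ ω, X ω ∂P = 0) : ∫⁻ ω, ‖X ω‖ₑ ∂P ≤ ENNReal.ofReal √Var[X; P] := by
  have h := variance_nonneg |X| P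
  rw [variance_eq_sub hX.abs] at h
  have habs : ∫ ω, |X ω| ∂P ≤ √Var[X; P] := by
    refine Real.le_sqrt_of_sq_le ?_
    rw [variance_of_integral_eq_zero hX.aemeasurable hmean]
    simpa using h
  rw [← ofReal_integral_norm_eq_lintegral_enorm (hX.integrable one_le_two)]
  exact ENNReal.ofReal_le_ofReal habs

end LinearForms

section CircularGaussian

theorem inner_sum_mul {ι : Type*} [Fintype ι] (x : ℂ) (z a : ι → ℂ) :
    ⟪x, ∑ k, z k * a k⟫ = (∑ k, z k * (conj x * a k)).re := by
  rw [Complex.inner, Finset.sum_mul]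
  simp only [mul_comm (conj x), mul_assoc]

theorem im_sum_mul {ι : Type*} [Fintype ι] (z a : ι → ℂ) :
    (∑ k, z k * a k).im = (∑ k, z k * (-Complex.I * a k)).re := by
  simp only [mul_left_comm _ (-Complex.I), ← Finset.mul_sum]
  simp

variable {Ω ι : Type*} [MeasurableSpace Ω] {P : Measure Ω}

/-- A family of complex random variables whose real and imaginary parts are all independent
standard Gaussians. The variance is `1` per real coordinate, so `𝔼 |ε k|² = 2`. -/
structure IsStdCircularGaussian (ε : ι → Ω → ℂ) (P : Measure Ω) : Prop where
  hasLaw_re : ∀ k, HasLaw (fun ω ↦ (ε k ω).re) (gaussianReal 0 1) P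
  hasLaw_im : ∀ k, HasLaw (fun ω ↦ (ε k ω).im) (gaussianReal 0 1) P
  iIndepFun_re_im : iIndepFun (Sum.elim (fun k ω ↦ (ε k ω).re) (fun k ω ↦ (ε k ω).im)) P

namespace IsStdCircularGaussian

variable {ε : ι → Ω → ℂ}

theorem of_eq_add_I_mul {ε₁ ε₂ : ι → Ω → ℝ} (hε₁ : ∀ k, HasLaw (ε₁ k) (gaussianReal 0 1) P)
    (hε₂ : ∀ k, HasLaw (ε₂ k) (gaussianReal 0 1) P) (hindep : iIndepFun (Sum.elim ε₁ ε₂) P)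
    (hε : ∀ k ω, ε k ω = ε₁ k ω + Complex.I * ε₂ k ω) : IsStdCircularGaussian ε P := by
  have hre : (fun k ω ↦ (ε k ω).re) = ε₁ := by
    ext k ω
    simp [hε]
  have him : (fun k ω ↦ (ε k ω).im) = ε₂ := by
    ext k ω
    simp [hε]
  exact ⟨fun k ↦ congrFun hre k ▸ hε₁ k, fun k ↦ congrFun him k ▸ hε₂ k,
    hre.symm ▸ him.symm ▸ hindep⟩

theorem hasLaw_re_im (hε : IsStdCircularGaussian ε P) (i : ι ⊕ ι) :
    HasLaw (Sum.elim (fun k ω ↦ (ε k ω).re) (fun k ω ↦ (ε k ω).im) i) (gaussianReal 0 1) P := by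
  rcases i with k | k
  exacts [hε.hasLaw_re k, hε.hasLaw_im k]

theorem isProbabilityMeasure (hε : IsStdCircularGaussian ε P) : IsProbabilityMeasure P :=
  hε.iIndepFun_re_im.isProbabilityMeasure

theorem aemeasurable (hε : IsStdCircularGaussian ε P) (k : ι) : AEMeasurable (ε k) P := by
  have h := (Complex.measurable_ofReal.comp_aemeasurable (hε.hasLaw_re k).aemeasurable).add
    ((Complex.measurable_ofReal.comp_aemeasurable (hε.hasLaw_im k).aemeasurable).mul_const
      Complex.I)
  exact h.congr (.of_forall fun ω ↦ Complex.re_add_im (ε k ω))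

variable [Fintype ι] (hε : IsStdCircularGaussian ε P) (a b : ι → ℂ)
include hε

theorem hasGaussianLaw_sum_mul_prodMk :
    HasGaussianLaw (fun ω ↦ (∑ k, ε k ω * a k, ∑ k, ε k ω * b k)) P := by
  let form (c : ι → ℂ) : (ι ⊕ ι → ℝ) →L[ℝ] ℂ := ∑ k,
    ((ContinuousLinearMap.proj (R := ℝ) (φ := fun _ : ι ⊕ ι ↦ ℝ) (.inl k)).smulRight (c k) +
      (ContinuousLinearMap.proj (R := ℝ) (φ := fun _ : ι ⊕ ι ↦ ℝ) (.inr k)).smulRight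
        (Complex.I * c k))
  have form_apply : ∀ c ω, form c
      (Sum.elim (fun k ω ↦ (ε k ω).re) (fun k ω ↦ (ε k ω).im) · ω) = ∑ k, ε k ω * c k := by
    intro c ω
    simp only [form, sum_apply, add_apply,
      ContinuousLinearMap.smulRight_apply, ContinuousLinearMap.proj_apply, Sum.elim_inl,
      Sum.elim_inr, Complex.real_smul]
    refine Finset.sum_congr rfl fun k _ ↦ ?_
    rw [← mul_assoc, ← add_mul, Complex.re_add_im]
  have h := (hε.iIndepFun_re_im.hasGaussianLaw fun i ↦ (hε.hasLaw_re_im i).hasGaussianLaw).map_fun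
    ((form a).prod (form b))
  simpa only [ContinuousLinearMap.prod_apply, form_apply] using h

theorem hasGaussianLaw_re_sum_mul : HasGaussianLaw (fun ω ↦ (∑ k, ε k ω * a k).re) P :=
  (hε.hasGaussianLaw_sum_mul_prodMk a a).fst.map_fun Complex.reCLM

theorem covariance_re_sum_mul :
    cov[fun ω ↦ (∑ k, ε k ω * a k).re, fun ω ↦ (∑ k, ε k ω * b k).re; P] =
      (∑ k, a k * conj (b k)).re := by
  have := hε.isProbabilityMeasure
  set W := Sum.elim (fun k ω ↦ (ε k ω).re) (fun k ω ↦ (ε k ω).im)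
  have hW : ∀ i, MemLp (W i) 2 P := fun i ↦ (hε.hasLaw_re_im i).hasGaussianLaw.memLp_two
  have re_eq : ∀ (c : ι → ℂ) ω, (∑ k, ε k ω * c k).re =
      ∑ i, Sum.elim (fun k ↦ (c k).re) (fun k ↦ -(c k).im) i * W i ω := by
    intro c ω
    simp only [W, Fintype.sum_sum_type, Sum.elim_inl, Sum.elim_inr, Complex.re_sum,
      Complex.mul_re, ← Finset.sum_add_distrib]
    exact Finset.sum_congr rfl fun k _ ↦ by ring
  simp only [re_eq]
  rw [covariance_sum_mul_sum_mul hW fun i j hij ↦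
    (hε.iIndepFun_re_im.indepFun hij).covariance_eq_zero (hW i) (hW j)]
  simp only [W, (hε.hasLaw_re_im _).variance_eq, variance_id_gaussianReal, NNReal.coe_one, mul_one,
    Fintype.sum_sum_type, Sum.elim_inl, Sum.elim_inr, Complex.re_sum, Complex.mul_re,
    Complex.conj_re, Complex.conj_im, ← Finset.sum_add_distrib]
  exact Finset.sum_congr rfl fun k _ ↦ by ring

theorem integral_re_sum_mul : ∫ ω, (∑ k, ε k ω * a k).re ∂P = 0 := by
  have hre := fun k ↦ (hε.hasLaw_re k).hasGaussianLaw.integrable.mul_const (a k).re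
  have him := fun k ↦ (hε.hasLaw_im k).hasGaussianLaw.integrable.mul_const (a k).im
  have hsub : ∀ k, Integrable
      (fun ω ↦ (ε k ω).re * (a k).re - (ε k ω).im * (a k).im) P := fun k ↦ (hre k).sub (him k)
  simp only [Complex.re_sum, Complex.mul_re]
  rw [integral_finsetSum _ fun k _ ↦ hsub k]
  refine Finset.sum_eq_zero fun k _ ↦ ?_
  rw [integral_sub (hre k) (him k), integral_mul_const, integral_mul_const,
    (hε.hasLaw_re k).integral_eq, (hε.hasLaw_im k).integral_eq]
  simp

theorem variance_re_sum_mul :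
    Var[fun ω ↦ (∑ k, ε k ω * a k).re; P] = ∑ k, ‖a k‖ ^ 2 := by
  rw [← covariance_self (hε.hasGaussianLaw_re_sum_mul a).aemeasurable, hε.covariance_re_sum_mul]
  simp only [Complex.mul_conj, Complex.normSq_eq_norm_sq, ← Complex.ofReal_sum, Complex.ofReal_re]

theorem hasLaw_re_sum_mul : HasLaw (fun ω ↦ (∑ k, ε k ω * a k).re)
    (gaussianReal 0 (∑ k, ‖a k‖₊ ^ 2)) P := by
  have h := hε.hasGaussianLaw_re_sum_mul a
  have hvar : Var[fun ω ↦ (∑ k, ε k ω * a k).re; P] = (∑ k, ‖a k‖₊ ^ 2 : ℝ≥0) := by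
    rw [hε.variance_re_sum_mul]
    push_cast
    rfl
  refine ⟨h.aemeasurable, ?_⟩
  rw [h.map_eq_gaussianReal, hε.integral_re_sum_mul, hvar, Real.toNNReal_coe]

theorem indepFun_sum_mul (hab : ∑ k, a k * conj (b k) = 0) :
    IndepFun (fun ω ↦ ∑ k, ε k ω * a k) (fun ω ↦ ∑ k, ε k ω * b k) P := by
  refine (hε.hasGaussianLaw_sum_mul_prodMk a b).indepFun_of_covariance_inner fun x y ↦ ?_
  have hxy : ∑ k, conj x * a k * conj (conj y * b k) = 0 := by
    rw [← mul_zero (conj x * y), ← hab, Finset.mul_sum]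
    refine Finset.sum_congr rfl fun k _ ↦ ?_
    rw [map_mul, Complex.conj_conj]
    ring
  simp only [inner_sum_mul, hε.covariance_re_sum_mul, hxy, Complex.zero_re]

theorem indepFun_re_im_sum_mul :
    IndepFun (fun ω ↦ (∑ k, ε k ω * a k).re) (fun ω ↦ (∑ k, ε k ω * a k).im) P := by
  simp only [im_sum_mul]
  refine HasGaussianLaw.indepFun_of_covariance_eq_zero ?_ ?_
  · exact (hε.hasGaussianLaw_sum_mul_prodMk a _).map_fun (Complex.reCLM.prodMap Complex.reCLM)
  · rw [hε.covariance_re_sum_mul, Complex.re_sum]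
    refine Finset.sum_eq_zero fun k _ ↦ ?_
    rw [map_mul, mul_left_comm, Complex.mul_conj]
    simp

theorem hasLaw_norm_sq_sum_mul (ha : 0 < ∑ k, ‖a k‖ ^ 2) :
    HasLaw (fun ω ↦ ‖∑ k, ε k ω * a k‖ ^ 2) (expMeasure (2 * ∑ k, ‖a k‖ ^ 2)⁻¹) P := by
  have := hε.isProbabilityMeasure
  have him : HasLaw (fun ω ↦ (∑ k, ε k ω * a k).im) (gaussianReal 0 (∑ k, ‖a k‖₊ ^ 2)) P := by
    simpa only [im_sum_mul, nnnorm_mul, nnnorm_neg, Complex.nnnorm_I, one_mul] using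
      hε.hasLaw_re_sum_mul fun k ↦ -Complex.I * a k
  have hv : ∑ k, ‖a k‖₊ ^ 2 ≠ 0 := fun h ↦ ha.ne' (by simpa using congrArg NNReal.toReal h)
  have h := hasLaw_sq_add_sq_of_indepFun hv (hε.hasLaw_re_sum_mul a) him
    (hε.indepFun_re_im_sum_mul a)
  push_cast at h
  simpa only [Complex.sq_norm, Complex.normSq_apply, ← sq] using h

theorem lintegral_enorm_inner_sum_mul_le (x : ℂ) :
    ∫⁻ ω, ‖⟪x, ∑ k, ε k ω * a k⟫‖ₑ ∂P ≤ ENNReal.ofReal √(∑ k, ‖a k‖ ^ 2) * ‖x‖ₑ := by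
  have := hε.isProbabilityMeasure
  simp only [inner_sum_mul]
  refine (lintegral_enorm_le_sqrt_variance (hε.hasGaussianLaw_re_sum_mul _).memLp_two
    (hε.integral_re_sum_mul _)).trans_eq ?_
  rw [hε.variance_re_sum_mul]
  simp only [norm_mul, mul_pow, ← Finset.mul_sum, RCLike.norm_conj]
  rw [Real.sqrt_mul (sq_nonneg _), Real.sqrt_sq (norm_nonneg _),
    ENNReal.ofReal_mul (norm_nonneg x), ofReal_norm, mul_comm]

end IsStdCircularGaussian

end CircularGaussian

section ClosedCurve

variable {Ω ι : Type*} [MeasurableSpace Ω] {P : Measure Ω} [Fintype ι] {ε : ι → Ω → ℂ}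

theorem IsStdCircularGaussian.aemeasurable_sum_mul_prod (hε : IsStdCircularGaussian ε P)
    {a : ℝ → ι → ℂ} (ha : Measurable a) :
    AEMeasurable (fun p : Ω × ℝ ↦ ∑ k, ε k p.1 * a p.2 k) (P.prod volume) :=
  Finset.univ.aemeasurable_fun_sum fun k _ ↦ (hε.aemeasurable k).comp_fst.mul
    (((measurable_pi_apply k).comp ha).comp measurable_snd).aemeasurable

theorem IsStdCircularGaussian.measure_exists_lt_norm_sum_mul_le (hε : IsStdCircularGaussian ε P)
    {a a' : ℝ → ι → ℂ} {u v w : ℝ} (ha : ∀ t, HasDerivAt a (a' t) t) (ha' : Continuous a')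
    (hloop : a 0 = a 1) (hv : 0 < v) (hav : ∀ t, ∑ k, ‖a t k‖ ^ 2 = v)
    (haw : ∀ t, ∑ k, ‖a' t k‖ ^ 2 = w) (horth : ∀ t, ∑ k, a t k * conj (a' t k) = 0)
    (hu : 0 ≤ u) :
    P {ω | ∃ t ∈ Icc (0 : ℝ) 1, u < ‖∑ k, ε k ω * a t k‖} ≤
      ENNReal.ofReal (Real.exp (-((2 * v)⁻¹ * u ^ 2)) * (1 + (2 * v)⁻¹ * √w * u)) := by
  have := hε.isProbabilityMeasure
  have hac : Continuous a := continuous_iff_continuousAt.2 fun t ↦ (ha t).continuousAt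
  have hderiv : ∀ ω t, HasDerivAt (fun t ↦ ∑ k, ε k ω * a t k) (∑ k, ε k ω * a' t k) t :=
    fun ω t ↦ HasDerivAt.fun_sum fun k _ ↦ (hasDerivAt_pi.1 (ha t) k).const_mul _
  have haemeas : ∀ c : ι → ℂ, AEMeasurable (fun ω ↦ ∑ k, ε k ω * c k) P := fun c ↦
    (hε.hasGaussianLaw_sum_mul_prodMk c c).fst.aemeasurable
  exact measure_exists_lt_norm_le (by positivity) hu (Real.sqrt_nonneg w) hderiv
    (fun ω ↦ by fun_prop) (fun ω ↦ by simp only [hloop])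
    (hε.aemeasurable_sum_mul_prod hac.measurable) (hε.aemeasurable_sum_mul_prod ha'.measurable)
    (fun t ↦ haemeas (a t)) (fun t ↦ haemeas (a' t))
    (fun t ↦ hav t ▸ hε.hasLaw_norm_sq_sum_mul (a t) (hav t ▸ hv))
    (fun t ↦ hε.indepFun_sum_mul (a t) (a' t) (horth t))
    (fun t ↦ haw t ▸ hε.lintegral_enorm_inner_sum_mul_le (a' t))

end ClosedCurve

section TrigonometricCurve

theorem norm_trigFun (k : ℤ) (t : ℝ) : ‖trigFun k t‖ = 1 := by
  have h : 2 * (Real.pi : ℂ) * Complex.I * k * t = ((2 * Real.pi * k * t : ℝ) : ℂ) * Complex.I := by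
    push_cast
    ring
  rw [trigFun, h, Complex.norm_exp_ofReal_mul_I]

theorem hasDerivAt_trigFun (k : ℤ) (t : ℝ) :
    HasDerivAt (trigFun k) (2 * Real.pi * Complex.I * k * trigFun k t) t := by
  have h := ((Complex.ofRealCLM.hasDerivAt (x := t)).const_mul
    (2 * (Real.pi : ℂ) * Complex.I * k)).cexp
  unfold trigFun
  simpa [mul_comm] using h

theorem continuous_trigFun (k : ℤ) : Continuous (trigFun k) := by
  unfold trigFun
  fun_prop

theorem trigFun_zero (k : ℤ) : trigFun k 0 = 1 := by simp [trigFun]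

theorem trigFun_one (k : ℤ) : trigFun k 1 = 1 := by
  have h : 2 * (Real.pi : ℂ) * Complex.I * k * (1 : ℝ) = k * (2 * Real.pi * Complex.I) := by
    push_cast
    ring
  rw [trigFun, h, Complex.exp_int_mul_two_pi_mul_I]

variable {Ω ι : Type*} [MeasurableSpace Ω] {P : Measure Ω} [Fintype ι] {ε : ι → Ω → ℂ}

theorem sum_trigFun_mul_conj_deriv {n : ι → ℤ} (hn : ∑ k, n k = 0) (t : ℝ) :
    ∑ k, trigFun (n k) t * conj (2 * Real.pi * Complex.I * n k * trigFun (n k) t) = 0 := by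
  have hterm : ∀ k, trigFun (n k) t * conj (2 * Real.pi * Complex.I * n k * trigFun (n k) t) =
      conj (2 * Real.pi * Complex.I) * n k := by
    intro k
    rw [map_mul, mul_left_comm, Complex.mul_conj, Complex.normSq_eq_norm_sq, norm_trigFun]
    simp
  simp only [hterm, ← Finset.mul_sum]
  rw [← Int.cast_sum, hn, Int.cast_zero, mul_zero]

theorem sum_norm_deriv_trigFun_sq (n : ι → ℤ) (t : ℝ) :
    ∑ k, ‖2 * Real.pi * Complex.I * n k * trigFun (n k) t‖ ^ 2 =
      (2 * Real.pi) ^ 2 * ∑ k, (n k : ℝ) ^ 2 := by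
  rw [Finset.mul_sum]
  refine Finset.sum_congr rfl fun k _ ↦ ?_
  simp [norm_trigFun, mul_pow]

theorem IsStdCircularGaussian.measure_exists_lt_norm_sum_trigFun_le [Nonempty ι]
    (hε : IsStdCircularGaussian ε P) {n : ι → ℤ} (hn : ∑ k, n k = 0) {u : ℝ} (hu : 0 ≤ u) :
    P {ω | ∃ t ∈ Icc (0 : ℝ) 1, u < ‖∑ k, ε k ω * trigFun (n k) t‖} ≤
      ENNReal.ofReal (Real.exp (-u ^ 2 / (2 * Fintype.card ι)) *
        (1 + Real.pi * u * √(∑ k, (n k : ℝ) ^ 2) / Fintype.card ι)) := by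
  have hcard : (0 : ℝ) < Fintype.card ι := Nat.cast_pos.2 Fintype.card_pos
  refine (hε.measure_exists_lt_norm_sum_mul_le
    (fun t ↦ hasDerivAt_pi.2 fun k ↦ hasDerivAt_trigFun (n k) t)
    (continuous_pi fun k ↦ continuous_const.mul (continuous_trigFun (n k)))
    (funext fun k ↦ by rw [trigFun_zero, trigFun_one]) hcard (fun t ↦ by simp [norm_trigFun])
    (sum_norm_deriv_trigFun_sq n) (sum_trigFun_mul_conj_deriv hn) hu).trans_eq ?_
  rw [Real.sqrt_mul (by positivity), Real.sqrt_sq (by positivity)]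
  congr 3
  · field_simp
  · field_simp

theorem exp_mul_one_add_pi_mul_le {x c : ℝ} (hc : 0 ≤ c) :
    Real.exp (-x ^ 2 / 2) * (1 + Real.pi * x * c) ≤
      4 * (Real.exp (-x ^ 2 / 2) + c * Real.exp (-x ^ 2 / 4)) := by
  -- Of the two factors in `e^{-x²/2} = e^{-x²/4} e^{-x²/4}`, one absorbs `π x`.
  have absorb : Real.pi * x * Real.exp (-x ^ 2 / 4) ≤ 4 := by
    have hquad : Real.pi * x ≤ x ^ 2 + 4 := by
      nlinarith [sq_nonneg (x - Real.pi / 2), Real.pi_pos, Real.pi_lt_d2]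
    have hexp : x ^ 2 / 4 + 1 ≤ Real.exp (x ^ 2 / 4) := Real.add_one_le_exp _
    rw [neg_div, Real.exp_neg, ← div_eq_mul_inv, div_le_iff₀ (Real.exp_pos _)]
    linarith
  have hsplit : Real.exp (-x ^ 2 / 2) = Real.exp (-x ^ 2 / 4) * Real.exp (-x ^ 2 / 4) := by
    rw [← Real.exp_add]
    ring_nf
  calc Real.exp (-x ^ 2 / 2) * (1 + Real.pi * x * c)
      = Real.exp (-x ^ 2 / 2) +
          Real.pi * x * Real.exp (-x ^ 2 / 4) * (c * Real.exp (-x ^ 2 / 4)) := by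
        rw [hsplit]
        ring
    _ ≤ 4 * Real.exp (-x ^ 2 / 2) + 4 * (c * Real.exp (-x ^ 2 / 4)) := by
        gcongr
        linarith [Real.exp_pos (-x ^ 2 / 2)]
    _ = _ := by ring

end TrigonometricCurve

section Frequencies

variable (fc : ℕ)

theorem sum_Icc_neg_succ {M : Type*} [AddCommMonoid M] (f : ℤ → M) :
    ∑ k ∈ Finset.Icc (-((fc + 1 : ℕ) : ℤ)) (fc + 1 : ℕ), f k =
      f (-(fc + 1)) + (f (fc + 1) + ∑ k ∈ Finset.Icc (-(fc : ℤ)) fc, f k) := by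
  have hIcc : Finset.Icc (-((fc + 1 : ℕ) : ℤ)) (fc + 1 : ℕ) =
      insert (-((fc : ℤ) + 1)) (insert ((fc : ℤ) + 1) (Finset.Icc (-(fc : ℤ)) fc)) := by
    ext k
    simp only [Finset.mem_Icc, Finset.mem_insert]
    lia
  rw [hIcc, Finset.sum_insert (by simp only [Finset.mem_Icc, Finset.mem_insert]; lia),
    Finset.sum_insert (by simp only [Finset.mem_Icc]; lia)]

theorem card_freq : Fintype.card (Freq fc) = 2 * fc + 1 := by
  rw [Fintype.card_coe, Int.card_Icc]
  lia

theorem sum_freq : ∑ k : Freq fc, (k : ℤ) = 0 := by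
  rw [Finset.sum_coe_sort (Finset.Icc (-(fc : ℤ)) fc) fun k ↦ k]
  induction fc with
  | zero => simp
  | succ n ih => rw [sum_Icc_neg_succ, ih]; ring

theorem sum_freq_sq :
    ∑ k : Freq fc, ((k : ℤ) : ℝ) ^ 2 = fc * (fc + 1) * (2 * fc + 1) / 3 := by
  rw [Finset.sum_coe_sort (Finset.Icc (-(fc : ℤ)) fc) fun k ↦ (k : ℝ) ^ 2]
  induction fc with
  | zero => simp
  | succ n ih => rw [sum_Icc_neg_succ, ih]; push_cast; ring

theorem sum_freq_sq_div_card :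
    (∑ k : Freq fc, ((k : ℤ) : ℝ) ^ 2) / (2 * fc + 1) = fc * (fc + 1) / 3 := by
  rw [sum_freq_sq]
  field_simp

end Frequencies

theorem mainTheorem5_general {Ω ι : Type*} [MeasurableSpace Ω] {P : Measure Ω} [Fintype ι]
    [Nonempty ι] {n : ι → ℤ} (hn : ∑ k, n k = 0) {ε₁ ε₂ : ι → Ω → ℝ}
    (hε₁ : ∀ k, HasLaw (ε₁ k) (gaussianReal 0 1) P) (hε₂ : ∀ k, HasLaw (ε₂ k) (gaussianReal 0 1) P)
    (hindep : iIndepFun (Sum.elim ε₁ ε₂) P) {ε : ι → Ω → ℂ}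
    (hε : ∀ k ω, ε k ω = ε₁ k ω + Complex.I * ε₂ k ω) {u : ℝ} (hu : 0 ≤ u) :
    P.real {ω | u < ⨆ t : Icc (0 : ℝ) 1, ‖∑ k, ε k ω * trigFun (n k) t‖} ≤
      4 * (Real.exp (-u ^ 2 / (2 * Fintype.card ι)) +
        √((∑ k, (n k : ℝ) ^ 2) / Fintype.card ι) *
          Real.exp (-u ^ 2 / (4 * Fintype.card ι))) := by
  have hgauss : IsStdCircularGaussian ε P := .of_eq_add_I_mul hε₁ hε₂ hindep hε
  set N := (Fintype.card ι : ℝ)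
  set S := ∑ k, (n k : ℝ) ^ 2
  have hN : 0 < N := Nat.cast_pos.2 Fintype.card_pos
  calc P.real {ω | u < ⨆ t : Icc (0 : ℝ) 1, ‖∑ k, ε k ω * trigFun (n k) t‖}
      ≤ Real.exp (-u ^ 2 / (2 * N)) * (1 + Real.pi * u * √S / N) := by
        refine ENNReal.toReal_le_of_le_ofReal (by positivity) (le_trans (measure_mono ?_)
          (hgauss.measure_exists_lt_norm_sum_trigFun_le hn hu))
        intro ω hω
        obtain ⟨t, ht⟩ := exists_lt_of_lt_ciSup (mem_ofPred.1 hω)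
        exact ⟨t, t.2, ht⟩
    _ = Real.exp (-(u / √N) ^ 2 / 2) * (1 + Real.pi * (u / √N) * √(S / N)) := by
        have hsq : √N * √N = N := Real.mul_self_sqrt hN.le
        rw [Real.sqrt_div' S hN.le, mul_div_assoc' Real.pi u, div_mul_div_comm, hsq, div_pow,
          Real.sq_sqrt hN.le, ← neg_div, div_div, mul_comm N]
    _ ≤ 4 * (Real.exp (-(u / √N) ^ 2 / 2) + √(S / N) * Real.exp (-(u / √N) ^ 2 / 4)) :=
        exp_mul_one_add_pi_mul_le (Real.sqrt_nonneg _)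
    _ = _ := by
        rw [div_pow, Real.sq_sqrt hN.le, ← neg_div, div_div, div_div, mul_comm N, mul_comm N]

theorem mainTheorem5 {Ω : Type*} [MeasurableSpace Ω]
    (P : MeasureTheory.Measure Ω) [MeasureTheory.IsProbabilityMeasure P]
    (fc : ℕ) (ε₁ ε₂ : Freq fc → Ω → ℝ)
    (hε₁ : ∀ k, ProbabilityTheory.HasLaw (ε₁ k) (ProbabilityTheory.gaussianReal 0 1) P)
    (hε₂ : ∀ k, ProbabilityTheory.HasLaw (ε₂ k) (ProbabilityTheory.gaussianReal 0 1) P)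
    (hindep : ProbabilityTheory.iIndepFun (Sum.elim ε₁ ε₂) P)
    (ε : Freq fc → Ω → ℂ)
    (hε : ∀ k ω, ε k ω = (ε₁ k ω : ℂ) + Complex.I * (ε₂ k ω : ℂ))
    (u : ℝ) (hu : √2 < u) :
    P.real {ω | u < ⨆ t : Set.Icc (0 : ℝ) 1, ‖trigPoly (fun k => ε k ω) (t : ℝ)‖} ≤
      4 * (Real.exp (-u ^ 2 / (2 * (2 * (fc : ℝ) + 1))) +
        √((fc : ℝ) * ((fc : ℝ) + 1) / 3) *
          Real.exp (-u ^ 2 / (4 * (2 * (fc : ℝ) + 1)))) := by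
  have : Nonempty (Freq fc) := ⟨⟨0, by simp⟩⟩
  have hu₀ : 0 ≤ u := (Real.sqrt_nonneg 2).trans hu.le
  simpa only [trigPoly, card_freq, Nat.cast_add, Nat.cast_mul, Nat.cast_ofNat,
    Nat.cast_one, sum_freq_sq_div_card] using
    mainTheorem5_general (sum_freq fc) hε₁ hε₂ hindep hε hu₀
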